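/- Let $G$ be the group of real matrices $\begin{pmatrix}1&x&z\\0&1&y\\0&0&1\end{pmatrix}$ (the $3$-dimensional Heisenberg group), $\Gamma\subset G$ the subgroup of matrices with integer entries, $\Gamma\backslash G=\{\Gamma g: g\in G\}$ with the quotient topology, and $\mathbb T=\mathbb R/\mathbb Z$. Let $\alpha\in[0,1)$ be irrational and let $\varphi,\psi:\mathbb R\to\mathbb R$ be $C^\infty$ functions, periodic with period $1$, with $\int_0^1\varphi(t)\,dt=0$. Put $X=\mathbb T\times\Gamma\backslash G$ and let $T:X\to X$ be the skew product $$T(t,\Gamma g)=\left(t+\alpha,\ \Gamma g\begin{pmatrix}1&\varphi(t)&\psi(t)\\0&1&\varphi(t)\\0&0&1\end{pmatrix}\right).$$ For a metric $d$ on $X$ that induces its topology, $n\ge1$ and $x,y\in X$ put $\overline d_n(x,y)=\frac1n\sum_{j=0}^{n-1}d(T^jx,T^jy)$, and for a Borel probability measure $\rho$ on $X$ and $\varepsilon>0$ let $s_n(X,T,d,\rho,\varepsilon)$ be the least $m\in\mathbb N$ for which there are $x_1,\dots,x_m\in X$ with $$\rho\Big(\bigcup_{j=1}^m\{y\in X:\overline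 d_n(x_j,y)<\varepsilon\}\Big)>1-\varepsilon.$$ Then for every $T$-invariant Borel probability measure $\rho$ on $X$ the measure complexity of $(X,T,\rho)$ is sub-polynomial: for every metric $d$ on $X$ that induces its topology, every $\tau>0$ and every $\varepsilon>0$, $$\liminf_{n\to\infty}\frac{s_n(X,T,d,\rho,\varepsilon)}{n^\tau}=0.$$ -/

import Mathlib

open MeasureTheory Filter Topology
open scoped ENNReal ContDiff

/-- The real Heisenberg group `G`: the element `⟨x, y, z⟩` stands for the unitriangular matrix
`!![1, x, z; 0, 1, y; 0, 0, 1]`. -/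
@[ext]
structure Heisenberg where
  x : ℝ
  y : ℝ
  z : ℝ

namespace Heisenberg

instance : Mul Heisenberg := ⟨fun g h => ⟨g.x + h.x, g.y + h.y, g.z + h.z + g.x * h.y⟩⟩
instance : One Heisenberg := ⟨⟨0, 0, 0⟩⟩
instance : Inv Heisenberg := ⟨fun g => ⟨-g.x, -g.y, g.x * g.y - g.z⟩⟩

@[simp] theorem mul_x (g h : Heisenberg) : (g * h).x = g.x + h.x := rfl
@[simp] theorem mul_y (g h : Heisenberg) : (g * h).y = g.y + h.y := rfl
@[simp] theorem mul_z (g h : Heisenberg) : (g * h).z = g.z + h.z + g.x * h.y := rfl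
@[simp] theorem one_x : (1 : Heisenberg).x = 0 := rfl
@[simp] theorem one_y : (1 : Heisenberg).y = 0 := rfl
@[simp] theorem one_z : (1 : Heisenberg).z = 0 := rfl
@[simp] theorem inv_x (g : Heisenberg) : g⁻¹.x = -g.x := rfl
@[simp] theorem inv_y (g : Heisenberg) : g⁻¹.y = -g.y := rfl
@[simp] theorem inv_z (g : Heisenberg) : g⁻¹.z = g.x * g.y - g.z := rfl

instance : Group Heisenberg :=
  Group.ofLeftAxioms
    (fun a b c => by ext <;> simp <;> ring)
    (fun a => by ext <;> simp)
    (fun a => by ext <;> simp)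

/-- The matrix that a triple stands for. -/
def toMatrix (g : Heisenberg) : Matrix (Fin 3) (Fin 3) ℝ :=
  !![1, g.x, g.z; 0, 1, g.y; 0, 0, 1]

/-- The group law is matrix multiplication. -/
theorem toMatrix_mul (g h : Heisenberg) : (g * h).toMatrix = g.toMatrix * h.toMatrix := by
  ext i j
  fin_cases i <;> fin_cases j <;> simp [toMatrix, Matrix.mul_apply, Fin.sum_univ_three] <;> ring

/-- The coordinates `(x, y, z)`. -/
def coords : Heisenberg ≃ ℝ × ℝ × ℝ where
  toFun g := (g.x, g.y, g.z)
  invFun p := ⟨p.1, p.2.1, p.2.2⟩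
  left_inv _ := rfl
  right_inv _ := rfl

/-- The usual topology of `ℝ³`. -/
instance : TopologicalSpace Heisenberg := TopologicalSpace.induced coords inferInstance

/-- The coordinates as a homeomorphism. -/
def coordsHomeo : Heisenberg ≃ₜ ℝ × ℝ × ℝ := coords.toHomeomorphOfIsInducing ⟨rfl⟩

theorem continuous_x : Continuous Heisenberg.x := coordsHomeo.continuous.fst
theorem continuous_y : Continuous Heisenberg.y := coordsHomeo.continuous.snd.fst
theorem continuous_z : Continuous Heisenberg.z := coordsHomeo.continuous.snd.snd

theorem continuous_of_coords {X : Type*} [TopologicalSpace X] {f : X → Heisenberg}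
    (hx : Continuous fun a => (f a).x) (hy : Continuous fun a => (f a).y)
    (hz : Continuous fun a => (f a).z) : Continuous f :=
  coordsHomeo.comp_continuous_iff.1 (hx.prodMk (hy.prodMk hz))

instance : IsTopologicalGroup Heisenberg where
  continuous_mul := by
    have hx := continuous_x
    have hy := continuous_y
    have hz := continuous_z
    apply continuous_of_coords <;> simp only [mul_x, mul_y, mul_z] <;> fun_prop
  continuous_inv := by
    have hx := continuous_x
    have hy := continuous_y
    have hz := continuous_z
    apply continuous_of_coords <;> simp only [inv_x, inv_y, inv_z] <;> fun_prop

instance : T2Space Heisenberg := coordsHomeo.isEmbedding.t2Space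
instance : SecondCountableTopology Heisenberg := coordsHomeo.secondCountableTopology
instance : LocallyCompactSpace Heisenberg :=
  coordsHomeo.isClosedEmbedding.locallyCompactSpace

/-- The subgroup `Γ` of integer points. -/
def lattice : Subgroup Heisenberg where
  carrier := {g | ∃ a b c : ℤ, g = ⟨a, b, c⟩}
  mul_mem' := by
    rintro _ _ ⟨a, b, c, rfl⟩ ⟨a', b', c', rfl⟩
    exact ⟨a + a', b + b', c + c' + a * b', by ext <;> simp⟩
  one_mem' := ⟨0, 0, 0, by ext <;> simp⟩
  inv_mem' := by
    rintro _ ⟨a, b, c, rfl⟩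
    exact ⟨-a, -b, a * b - c, by ext <;> simp⟩

end Heisenberg

/-- The Heisenberg nilmanifold `Γ \ G`: the space of cosets `Γ g`, that is, of orbits of the left
multiplication action of `Γ` on `G`. -/
def HeisenbergNilmanifold : Type := Quotient (QuotientGroup.rightRel Heisenberg.lattice)

namespace HeisenbergNilmanifold

/-- The coset `Γ g`. -/
def mk (g : Heisenberg) : HeisenbergNilmanifold :=
  Quotient.mk (QuotientGroup.rightRel Heisenberg.lattice) g

/-- The quotient topology. -/
instance : TopologicalSpace HeisenbergNilmanifold :=
  inferInstanceAs (TopologicalSpace (Quotient (QuotientGroup.rightRel Heisenberg.lattice)))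

/-- The Borel `σ`-algebra. -/
instance : MeasurableSpace HeisenbergNilmanifold := borel _
instance : BorelSpace HeisenbergNilmanifold := ⟨rfl⟩

/-- Right translation `Γ g ↦ Γ g h`. -/
def rightTranslate (h : Heisenberg) : HeisenbergNilmanifold → HeisenbergNilmanifold :=
  Quotient.map (fun g => g * h) (by
    intro a b hab
    rw [← Quotient.eq_iff_equiv, Quotient.eq, QuotientGroup.rightRel_apply] at hab ⊢
    simpa [mul_assoc] using hab)

theorem rightTranslate_mk (g h : Heisenberg) : rightTranslate h (mk g) = mk (g * h) := rfl

/-- Two points of `G` give the same coset iff they differ by an element of `Γ` on the left. -/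
theorem mk_eq_mk_iff (g h : Heisenberg) :
    mk g = mk h ↔ ∃ γ ∈ Heisenberg.lattice, h = γ * g := by
  refine (Quotient.eq (r := QuotientGroup.rightRel Heisenberg.lattice)).trans ?_
  rw [QuotientGroup.rightRel_apply]
  exact ⟨fun H => ⟨_, H, by simp⟩, by rintro ⟨γ, H, rfl⟩; simpa using H⟩

instance : SecondCountableTopology HeisenbergNilmanifold :=
  ContinuousConstSMul.secondCountableTopology (Γ := Heisenberg.lattice) (T := Heisenberg)

instance : CompactSpace HeisenbergNilmanifold := by
  let K : Set Heisenberg := Heisenberg.coordsHomeo ⁻¹'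
    (Set.Icc 0 1 ×ˢ Set.Icc 0 1 ×ˢ Set.Icc 0 1)
  have hK : IsCompact K := Heisenberg.coordsHomeo.isCompact_preimage.2
    (isCompact_Icc.prod (isCompact_Icc.prod isCompact_Icc))
  have hc : Continuous mk := continuous_quotient_mk'
  refine ⟨?_⟩
  convert hK.image hc using 1
  symm
  rw [Set.eq_univ_iff_forall]
  intro p
  induction p using Quotient.inductionOn with
  | h g =>
    let γ : Heisenberg := ⟨(-⌊g.x⌋ : ℤ), (-⌊g.y⌋ : ℤ), (-⌊g.z + (-⌊g.x⌋ : ℤ) * g.y⌋ : ℤ)⟩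
    refine ⟨γ * g, ?_, ((mk_eq_mk_iff g (γ * g)).2 ⟨γ, ⟨_, _, _, rfl⟩, rfl⟩).symm⟩
    have h1 := Int.floor_le g.x
    have h2 := Int.lt_floor_add_one g.x
    have h3 := Int.floor_le g.y
    have h4 := Int.lt_floor_add_one g.y
    have h5 := Int.floor_le (g.z + (-⌊g.x⌋ : ℤ) * g.y)
    have h6 := Int.lt_floor_add_one (g.z + (-⌊g.x⌋ : ℤ) * g.y)
    refine ⟨⟨?_, ?_⟩, ⟨?_, ?_⟩, ?_, ?_⟩ <;>
      simp only [γ, Heisenberg.coordsHomeo, Heisenberg.coords,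
        Equiv.toHomeomorphOfIsInducing_apply, Equiv.coe_fn_mk, Heisenberg.mul_x, Heisenberg.mul_y,
        Heisenberg.mul_z] <;> push_cast at * <;> linarith

instance : T2Space HeisenbergNilmanifold := by
  have hS : Tendsto Heisenberg.lattice.subtype cofinite (cocompact Heisenberg) := by
    let e : Heisenberg.lattice → ℤ × ℤ × ℤ := fun γ => (⌊γ.1.x⌋, ⌊γ.1.y⌋, ⌊γ.1.z⌋)
    let f : ℤ × ℤ × ℤ → ℝ × ℝ × ℝ := Prod.map (↑) (Prod.map (↑) (↑))
    have hfe : ∀ γ : Heisenberg.lattice, Heisenberg.coordsHomeo.symm (f (e γ)) = γ := by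
      rintro ⟨_, a, b, c, rfl⟩
      rw [Homeomorph.symm_apply_eq]
      simp [f, e, Heisenberg.coordsHomeo, Heisenberg.coords]
    have he : Function.Injective e := fun a b h => by
      apply Subtype.ext
      rw [← hfe a, ← hfe b, h]
    have hf : Tendsto f cofinite (cocompact _) := by
      have h := Int.tendsto_coe_cofinite
      rw [← coprod_cofinite, ← coprod_cofinite, ← coprod_cocompact, ← coprod_cocompact]
      exact h.prodMap_coprod (h.prodMap_coprod h)
    have h := (Heisenberg.coordsHomeo.symm.isClosedEmbedding.tendsto_cocompact.comp hf).comp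
      he.tendsto_cofinite
    exact h.congr hfe
  have := Heisenberg.lattice.properlyDiscontinuousSMul_of_tendsto_cofinite hS
  exact t2Space_of_properlyDiscontinuousSMul_of_t2Space (Γ := Heisenberg.lattice)
    (T := Heisenberg)

end HeisenbergNilmanifold

/-- The skew product `(t, Γ g) ↦ (t + α, Γ g ⟨φ(t), φ(t), ψ(t)⟩)` on `𝕋 × Γ \ G`, where `𝕋 = ℝ/ℤ`
and the `1`-periodic functions `φ`, `ψ` are read as functions on `𝕋`. -/
noncomputable def skewProduct (α : ℝ) {φ ψ : ℝ → ℝ} (hφ : Function.Periodic φ 1)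
    (hψ : Function.Periodic ψ 1) (p : UnitAddCircle × HeisenbergNilmanifold) :
    UnitAddCircle × HeisenbergNilmanifold :=
  (p.1 + (α : UnitAddCircle),
    HeisenbergNilmanifold.rightTranslate ⟨hφ.lift p.1, hφ.lift p.1, hψ.lift p.1⟩ p.2)

section MeasureComplexity

variable {X : Type*}

/-- The averaged orbit distance `(1/n) ∑_{j < n} d (T^j x) (T^j y)`. -/
noncomputable def meanOrbitDist (d : X → X → ℝ) (T : X → X) (n : ℕ) (x y : X) : ℝ :=
  (1 / (n : ℝ)) * ∑ j ∈ Finset.range n, d (T^[j] x) (T^[j] y)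

/-- The ball of radius `ε` around `x` for the averaged orbit distance. -/
def meanOrbitBall (d : X → X → ℝ) (T : X → X) (n : ℕ) (x : X) (ε : ℝ) : Set X :=
  {y | meanOrbitDist d T n x y < ε}

/-- `s_n(X, T, d, ρ, ε)`: the least `m` such that some `m` balls of radius `ε` for the averaged
orbit distance have a union of measure greater than `1 - ε` (it is `⊤` if there is no such `m`). -/
noncomputable def coveringNumber [MeasurableSpace X] (d : X → X → ℝ) (T : X → X) (ρ : Measure X)
    (ε : ℝ) (n : ℕ) : ℕ∞ :=
  ⨅ (m : ℕ) (_ : ∃ c : Fin m → X, 1 - ε < ρ.real (⋃ j, meanOrbitBall d T n (c j) ε)), (m : ℕ∞)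

/-- The measure complexity of `(X, d, T, ρ)` is weaker than `u`. -/
def MeasureComplexityWeakerFor [MeasurableSpace X] (d : X → X → ℝ) (T : X → X) (ρ : Measure X)
    (u : ℕ → ℝ) : Prop :=
  ∀ ε : ℝ, 0 < ε →
    liminf (fun n : ℕ => (coveringNumber d T ρ ε n : ℝ≥0∞) / ENNReal.ofReal (u n)) atTop = 0

/-- The measure complexity of `(X, T, ρ)` is weaker than `u`: this holds for every metric that
induces the topology of `X`. -/
def MeasureComplexityWeaker [TopologicalSpace X] [MeasurableSpace X] (T : X → X)
    (ρ : Measure X) (u : ℕ → ℝ) : Prop :=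
  ∀ m : MetricSpace X, m.toUniformSpace.toTopologicalSpace = ‹TopologicalSpace X› →
    MeasureComplexityWeakerFor m.dist T ρ u

/-- The measure complexity of `(X, T, ρ)` is sub-polynomial. -/
def SubpolynomialMeasureComplexity [TopologicalSpace X] [MeasurableSpace X] (T : X → X)
    (ρ : Measure X) : Prop :=
  ∀ τ : ℝ, 0 < τ → MeasureComplexityWeaker T ρ (fun n : ℕ => (n : ℝ) ^ τ)

end MeasureComplexity

/-! The elements `exp (a (X + Y) + b Z)` of the Heisenberg group commute with each other and the
cocycle of the skew product takes values among them, so its iterates are given by the Birkhoff sums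
`S_j φ` and `S_j η`, where `η = ψ - φ ^ 2 / 2`. Let `Q` be the denominator of a rational number
within `1 / Q ^ 2` of `α`, and let `j ≤ Q ^ M`. Then `S_j φ`, `S_j φ'` and `S_j η'` are `O(Q ^ 2)`:
the frequencies `|m| < Q` are controlled by the small-divisor bound `‖m α‖ ≥ 1 / Q ^ 2`, the others
by the decay of the Fourier coefficients. Hence points at distance `O(Q ^ (-2))` stay `ε`-close for
`Q ^ M` steps, so that `O(Q ^ 8)` balls cover the four-dimensional space. The exponent `8` does not
depend on `M`, and `M` is arbitrary. -/

section Fourier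

variable {T : ℝ}

theorem continuous_periodic_lift {X : Type*} [TopologicalSpace X] {f : ℝ → X}
    (hf : Continuous f) (hp : Function.Periodic f T) : Continuous (hp.lift : AddCircle T → X) :=
  continuous_quot_lift _ hf

theorem periodic_deriv {𝕜 F : Type*} [NontriviallyNormedField 𝕜] [NormedAddCommGroup F]
    [NormedSpace 𝕜 F] {f : 𝕜 → F} {c : 𝕜} (hp : Function.Periodic f c) :
    Function.Periodic (deriv f) c := fun x => by
  rw [← deriv_comp_add_const f c x, funext hp]

theorem norm_fourier_apply (m : ℤ) (x : AddCircle T) : ‖(fourier m x : ℂ)‖ = 1 := by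
  rw [fourier_apply, Circle.norm_coe]

variable [hT : Fact (0 < T)]

theorem norm_fourierCoeff_le {E : Type*} [NormedAddCommGroup E] [NormedSpace ℂ E]
    {f : AddCircle T → E} {C : ℝ} (hf : ∀ x, ‖f x‖ ≤ C) (m : ℤ) : ‖fourierCoeff f m‖ ≤ C := by
  simpa [fourierCoeff] using norm_integral_le_of_norm_le_const (μ := AddCircle.haarAddCircle)
    (f := fun x => fourier (-m) x • f x)
    (Eventually.of_forall fun x => by
      rw [norm_smul, norm_fourier_apply, one_mul]; exact hf x)

theorem fourierCoeff_lift_deriv {f : ℝ → ℂ} (hf : ContDiff ℝ 1 f) (hp : Function.Periodic f T)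
    (m : ℤ) :
    fourierCoeff (periodic_deriv hp).lift m =
      2 * Real.pi * Complex.I * m / T * fourierCoeff hp.lift m := by
  have hboundary : fourier (-m) ((T : ℝ) : AddCircle T) * f T =
      fourier (-m) ((0 : ℝ) : AddCircle T) * f 0 := by
    rw [AddCircle.coe_period, ← AddCircle.coe_zero, hp.eq]
  have hparts := intervalIntegral.integral_mul_deriv_eq_deriv_mul (a := 0) (b := T)
    (fun x _ => hasDerivAt_fourier_neg T m x)
    (fun x _ => (hf.differentiable one_ne_zero x).hasDerivAt)
    (Continuous.intervalIntegrable (by fun_prop) _ _)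
    ((hf.continuous_deriv le_rfl).intervalIntegrable _ _)
  rw [hboundary, sub_self, zero_sub] at hparts
  rw [fourierCoeff_eq_intervalIntegral _ _ 0, fourierCoeff_eq_intervalIntegral _ _ 0, zero_add]
  simp only [Function.Periodic.lift_coe, smul_eq_mul]
  rw [hparts, ← intervalIntegral.integral_neg, mul_smul_comm,
    ← intervalIntegral.integral_const_mul]
  congr 2 with x
  ring

theorem exists_norm_fourierCoeff_mul_pow_le {N : ℕ} {f : ℝ → ℂ} (hf : ContDiff ℝ N f)
    (hp : Function.Periodic f T) :
    ∃ C : ℝ, ∀ m : ℤ, ‖fourierCoeff hp.lift m‖ * |(m : ℝ)| ^ N ≤ C := by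
  induction N generalizing f with
  | zero =>
    obtain ⟨C, hC⟩ := isCompact_univ.exists_bound_of_continuousOn
      (continuous_periodic_lift hf.continuous hp).continuousOn
    exact ⟨C, fun m => by
      simpa using norm_fourierCoeff_le (fun x => hC x (Set.mem_univ x)) m⟩
  | succ N ih =>
    have hf' : ContDiff ℝ N (deriv f) := (contDiff_succ_iff_deriv.1 (by exact_mod_cast hf)).2.2
    obtain ⟨C, hC⟩ := ih hf' (periodic_deriv hp)
    have hT0 := hT.out
    refine ⟨T / (2 * Real.pi) * C, fun m => ?_⟩
    have hderiv : ‖fourierCoeff (periodic_deriv hp).lift m‖ =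
        2 * Real.pi * |(m : ℝ)| / T * ‖fourierCoeff hp.lift m‖ := by
      rw [fourierCoeff_lift_deriv (hf.of_le (by norm_cast; omega)) hp m]
      simp [abs_of_pos Real.pi_pos, abs_of_pos hT0]
    calc ‖fourierCoeff hp.lift m‖ * |(m : ℝ)| ^ (N + 1)
        = T / (2 * Real.pi) * (‖fourierCoeff (periodic_deriv hp).lift m‖ * |(m : ℝ)| ^ N) := by
          rw [hderiv, pow_succ]; field_simp
      _ ≤ T / (2 * Real.pi) * C := by gcongr; exact hC m

theorem hasSum_fourierCoeff_mul_birkhoffSum {F : C(AddCircle T, ℂ)}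
    (hF : Summable (fourierCoeff F)) (R : AddCircle T → AddCircle T) (j : ℕ) (x : AddCircle T) :
    HasSum (fun m => fourierCoeff F m * birkhoffSum R (fourier m) j x) (birkhoffSum R F j x) := by
  simp only [birkhoffSum, Finset.mul_sum]
  exact hasSum_sum fun i _ => has_pointwise_sum_fourier_series_of_summable hF (R^[i] x)

end Fourier

section Diophantine

theorem four_mul_norm_le_norm_toCircle_sub_one (x : UnitAddCircle) :
    4 * ‖x‖ ≤ ‖(AddCircle.toCircle x : ℂ) - 1‖ := by
  obtain ⟨y, rfl, hy⟩ : ∃ y : ℝ, (y : UnitAddCircle) = x ∧ |y| ≤ 1 / 2 := by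
    induction x using QuotientAddGroup.induction_on with
    | H t =>
      exact ⟨t - round t, by simp, abs_sub_round t⟩
  have hnorm : ‖(y : UnitAddCircle)‖ = |y| :=
    (AddCircle.norm_coe_eq_abs_iff 1 one_ne_zero).2 (by simpa using hy)
  have hsin := Real.mul_abs_le_abs_sin (x := Real.pi * y) (by
    rw [abs_mul, abs_of_pos Real.pi_pos]; nlinarith [Real.pi_pos])
  rw [AddCircle.toCircle_apply_mk, Circle.coe_exp, mul_comm _ Complex.I,
    Complex.norm_exp_I_mul_ofReal_sub_one, hnorm, norm_mul, Real.norm_eq_abs, Real.norm_eq_abs]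
  calc 4 * |y| = |2| * (2 / Real.pi * |Real.pi * y|) := by
        rw [abs_mul, abs_of_pos Real.pi_pos, abs_two]; field_simp; ring
    _ ≤ |2| * |Real.sin (Real.pi * y)| := by gcongr
    _ = |2| * |Real.sin (2 * Real.pi / 1 * y / 2)| := by congr 3; ring

theorem norm_birkhoffSum_fourier_mul_le (a x : UnitAddCircle) (m : ℤ) (j : ℕ) :
    ‖birkhoffSum (· + a) (fourier m) j x‖ * (2 * ‖m • a‖) ≤ 1 := by
  have htelescope : ((AddCircle.toCircle (m • a) : ℂ) - 1) * birkhoffSum (· + a) (fourier m) j x =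
      fourier m ((· + a)^[j] x) - fourier m x := by
    rw [← birkhoffSum_apply_sub_birkhoffSum, sub_mul, one_mul]
    congr 1
    simp only [birkhoffSum, Finset.mul_sum]
    refine Finset.sum_congr rfl fun i _ => ?_
    rw [← Function.iterate_succ_apply, Function.iterate_succ_apply']
    simp [fourier_apply, smul_add, AddCircle.toCircle_add, mul_comm]
  have htwo :
      ‖(AddCircle.toCircle (m • a) : ℂ) - 1‖ * ‖birkhoffSum (· + a) (fourier m) j x‖ ≤ 2 := by
    rw [← norm_mul, htelescope]
    exact (norm_sub_le _ _).trans (by rw [norm_fourier_apply, norm_fourier_apply]; norm_num)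
  nlinarith [four_mul_norm_le_norm_toCircle_sub_one (m • a),
    norm_nonneg (birkhoffSum (· + a) (fourier m) j x)]

/-- The small-divisor condition on the rotation by `a` at the frequencies `0 < |m| < Q`. It holds
when `Q` is the denominator of a convergent of `a`. -/
def SeparatedUpTo (a : UnitAddCircle) (Q : ℕ) : Prop :=
  ∀ m : ℤ, m ≠ 0 → |m| < Q → 1 / (Q : ℝ) ^ 2 ≤ ‖m • a‖

theorem one_div_den_le_norm_zsmul {q : ℚ} {m : ℤ} (hm : ¬(q.den : ℤ) ∣ m) :
    1 / (q.den : ℝ) ≤ ‖m • ((q : ℝ) : UnitAddCircle)‖ := by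
  set u : UnitAddCircle := ((q : ℝ) : UnitAddCircle) with hu
  have horder : addOrderOf u = q.den := by
    simpa [hu] using AddCircle.addOrderOf_coe_rat (p := (1 : ℝ)) (q := q)
  have hfin : IsOfFinAddOrder u := addOrderOf_pos_iff.1 (horder ▸ q.den_pos)
  have hle : addOrderOf (m • u) ≤ q.den :=
    addOrderOf_le_of_nsmul_eq_zero q.den_pos <| by
      rw [smul_comm, ← horder, addOrderOf_nsmul_eq_zero, smul_zero]
  have hne : m • u ≠ 0 := by rwa [ne_eq, ← addOrderOf_dvd_iff_zsmul_eq_zero, horder]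
  rw [div_le_iff₀' (by exact_mod_cast q.den_pos)]
  calc (1 : ℝ) ≤ addOrderOf (m • u) * ‖m • u‖ := by
        simpa using AddCircle.le_add_order_smul_norm_of_isOfFinAddOrder hfin.zsmul hne
    _ ≤ q.den * ‖m • u‖ := by gcongr

theorem separatedUpTo_den {α : ℝ} {q : ℚ} (hq : |α - q| ≤ 1 / (q.den : ℝ) ^ 2) :
    SeparatedUpTo α q.den := by
  intro m hm hmq
  have hm' : |(m : ℝ)| ≤ q.den - 1 := by exact_mod_cast Int.le_sub_one_of_lt hmq
  have hdvd : ¬(q.den : ℤ) ∣ m := fun h =>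
    hmq.not_ge (Int.le_of_dvd (abs_pos.2 hm) ((dvd_abs _ _).2 h))
  have hdiff : ‖m • ((q : ℝ) : UnitAddCircle)‖ - ‖m • (α : UnitAddCircle)‖ ≤
      (q.den - 1) * (1 / (q.den : ℝ) ^ 2) := by
    calc ‖m • ((q : ℝ) : UnitAddCircle)‖ - ‖m • (α : UnitAddCircle)‖
        ≤ ‖m • (α : UnitAddCircle) - m • ((q : ℝ) : UnitAddCircle)‖ := by
          rw [norm_sub_rev]; exact norm_sub_norm_le _ _
      _ = ‖m • ((α - q : ℝ) : UnitAddCircle)‖ := by rw [AddCircle.coe_sub, smul_sub]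
      _ ≤ ‖m‖ * ‖((α - q : ℝ) : UnitAddCircle)‖ := norm_zsmul_le m _
      _ ≤ |(m : ℝ)| * |α - q| := by
          gcongr
          · exact (Int.norm_eq_abs m).le
          · exact QuotientAddGroup.norm_mk_le_norm
      _ ≤ (q.den - 1) * (1 / (q.den : ℝ) ^ 2) :=
          mul_le_mul hm' hq (abs_nonneg _) ((abs_nonneg _).trans hm')
  have hcancel : 1 / (q.den : ℝ) - (q.den - 1) * (1 / (q.den : ℝ) ^ 2) = 1 / (q.den : ℝ) ^ 2 := by
    field_simp
    ring
  linarith [one_div_den_le_norm_zsmul hdvd]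

theorem frequently_separatedUpTo {α : ℝ} (hα : Irrational α) :
    ∃ᶠ Q : ℕ in atTop, SeparatedUpTo α Q := by
  refine frequently_atTop'.2 fun B => ?_
  obtain ⟨n, hfar, hn⟩ := ((tendsto_one_div_atTop_nhds_zero_nat.eventually
    (hα.eventually_forall_le_dist_cast_rat_of_den_le B)).and (eventually_gt_atTop 0)).exists
  obtain ⟨q, hq, hqn⟩ := Real.exists_rat_abs_sub_le_and_den_le α hn
  have hden : (1 : ℝ) ≤ q.den := by exact_mod_cast q.den_pos
  have hn' : (0 : ℝ) < n := by exact_mod_cast hn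
  have hqn' : (q.den : ℝ) ≤ n := by exact_mod_cast hqn
  refine ⟨q.den, ?_, separatedUpTo_den (hq.trans ?_)⟩
  · by_contra! hB
    have hlt : 1 / ((n + 1 : ℝ) * q.den) < 1 / n :=
      one_div_lt_one_div_of_lt hn' (by nlinarith)
    exact (hfar q hB).not_gt (hq.trans_lt hlt)
  · exact one_div_le_one_div_of_le (by positivity) (by nlinarith)

end Diophantine

section Rotation

theorem birkhoffSum_comp_of_semiconj {X Y E : Type*} [AddCommMonoid E] {h : X → Y} {R : X → X}
    {S : Y → Y} (hRS : Function.Semiconj h R S) (g : Y → E) (n : ℕ) (x : X) :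
    birkhoffSum R (g ∘ h) n x = birkhoffSum S g n (h x) :=
  Finset.sum_congr rfl fun i _ => congrArg g (hRS.iterate_right i x)

theorem norm_birkhoffSum_fourier_le {a : UnitAddCircle} {Q M j : ℕ} (hQ : 0 < Q)
    (hsep : SeparatedUpTo a Q) (hj : j ≤ Q ^ M) {m : ℤ} (hm : m ≠ 0) (x : UnitAddCircle) :
    ‖birkhoffSum (· + a) (fourier m) j x‖ ≤ (Q : ℝ) ^ 2 * |(m : ℝ)| ^ M := by
  have hQ1 : (1 : ℝ) ≤ Q := by exact_mod_cast hQ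
  rcases lt_or_ge |m| (Q : ℤ) with hmQ | hmQ
  · have hsmall : 2 / (Q : ℝ) ^ 2 ≤ 2 * ‖m • a‖ := by
      have := hsep m hm hmQ
      rw [← mul_one_div]
      gcongr
    calc ‖birkhoffSum (· + a) (fourier m) j x‖ ≤ (Q : ℝ) ^ 2 / 2 := by
          rw [le_div_iff₀ two_pos, ← div_le_one₀ (by positivity), mul_div_assoc]
          exact (by gcongr : _ ≤ _).trans (norm_birkhoffSum_fourier_mul_le a x m j)
      _ ≤ (Q : ℝ) ^ 2 * 1 := by linarith [sq_nonneg (Q : ℝ)]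
      _ ≤ (Q : ℝ) ^ 2 * |(m : ℝ)| ^ M := by
          gcongr
          exact one_le_pow₀ (by exact_mod_cast Int.one_le_abs hm)
  · have hj' : (j : ℝ) ≤ (Q : ℝ) ^ M := by exact_mod_cast hj
    have htrivial : ‖birkhoffSum (· + a) (fourier m) j x‖ ≤ j := by
      refine (norm_sum_le _ _).trans_eq ?_
      simp only [norm_fourier_apply, Finset.sum_const, Finset.card_range, nsmul_one]
    calc ‖birkhoffSum (· + a) (fourier m) j x‖
        ≤ (Q : ℝ) ^ M := htrivial.trans hj'
      _ ≤ |(m : ℝ)| ^ M := by gcongr; exact_mod_cast hmQ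
      _ ≤ (Q : ℝ) ^ 2 * |(m : ℝ)| ^ M :=
          le_mul_of_one_le_left (by positivity) (one_le_pow₀ hQ1)

theorem norm_birkhoffSum_le {F : C(UnitAddCircle, ℂ)} {C : ℝ} {M : ℕ} (h0 : fourierCoeff F 0 = 0)
    (hC : ∀ m : ℤ, ‖fourierCoeff F m‖ * |(m : ℝ)| ^ (M + 2) ≤ C) {a : UnitAddCircle} {Q j : ℕ}
    (hQ : 0 < Q) (hsep : SeparatedUpTo a Q) (hj : j ≤ Q ^ M) (x : UnitAddCircle) :
    ‖birkhoffSum (· + a) F j x‖ ≤ C * (∑' m : ℤ, 1 / (m : ℝ) ^ 2) * (Q : ℝ) ^ 2 := by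
  have hsummable := (Real.summable_one_div_int_pow (p := 2).2 one_lt_two).mul_left C
  have hdecay (m : ℤ) : ‖fourierCoeff F m‖ * |(m : ℝ)| ^ M ≤ C * (1 / (m : ℝ) ^ 2) := by
    rcases eq_or_ne m 0 with rfl | hm
    · simp [h0]
    · rw [mul_one_div, le_div_iff₀ (by positivity), mul_assoc, ← sq_abs, ← pow_add]
      exact hC m
  have hcoeff (m : ℤ) : ‖fourierCoeff F m‖ ≤ ‖fourierCoeff F m‖ * |(m : ℝ)| ^ M := by
    rcases eq_or_ne m 0 with rfl | hm
    · simp [h0]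
    · exact le_mul_of_one_le_right (norm_nonneg _)
        (one_le_pow₀ (by exact_mod_cast Int.one_le_abs hm))
  have hF : Summable (fourierCoeff F) :=
    Summable.of_norm_bounded hsummable fun m => (hcoeff m).trans (hdecay m)
  have hterm (m : ℤ) : ‖fourierCoeff F m * birkhoffSum (· + a) (fourier m) j x‖ ≤
      C * (1 / (m : ℝ) ^ 2) * (Q : ℝ) ^ 2 := by
    rcases eq_or_ne m 0 with rfl | hm
    · simp [h0]
    · calc ‖fourierCoeff F m * birkhoffSum (· + a) (fourier m) j x‖
          ≤ ‖fourierCoeff F m‖ * ((Q : ℝ) ^ 2 * |(m : ℝ)| ^ M) := by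
            rw [norm_mul]; gcongr; exact norm_birkhoffSum_fourier_le hQ hsep hj hm x
        _ = ‖fourierCoeff F m‖ * |(m : ℝ)| ^ M * (Q : ℝ) ^ 2 := by ring
        _ ≤ C * (1 / (m : ℝ) ^ 2) * (Q : ℝ) ^ 2 :=
          mul_le_mul_of_nonneg_right (hdecay m) (by positivity)
  rw [← tsum_mul_left]
  exact (hasSum_fourierCoeff_mul_birkhoffSum hF _ j x).norm_le_of_bounded
    (hsummable.hasSum.mul_right _) hterm

theorem exists_abs_birkhoffSum_le (α : ℝ) {M : ℕ} {f : ℝ → ℝ} (hf : ContDiff ℝ (M + 2 : ℕ) f)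
    (hp : Function.Periodic f 1) (h0 : ∫ t in (0 : ℝ)..1, f t = 0) :
    ∃ C : ℝ, ∀ Q : ℕ, 0 < Q → SeparatedUpTo α Q → ∀ j ≤ Q ^ M, ∀ t : ℝ,
      |birkhoffSum (· + α) f j t| ≤ C * (Q : ℝ) ^ 2 := by
  have hfc : ContDiff ℝ (M + 2 : ℕ) fun t => (f t : ℂ) := Complex.ofRealCLM.contDiff.comp hf
  have hpc : Function.Periodic (fun t => (f t : ℂ)) 1 := fun t => congrArg _ (hp t)
  let F : C(UnitAddCircle, ℂ) := ⟨hpc.lift, continuous_periodic_lift hfc.continuous hpc⟩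
  obtain ⟨C, hC⟩ := exists_norm_fourierCoeff_mul_pow_le hfc hpc
  have hmean : fourierCoeff F 0 = 0 := by
    rw [fourierCoeff_eq_intervalIntegral _ _ 0]
    simp [F, intervalIntegral.integral_ofReal, h0]
  refine ⟨C * ∑' m : ℤ, 1 / (m : ℝ) ^ 2, fun Q hQ hsep j hj t => ?_⟩
  have hsum : ((birkhoffSum (· + α) f j t : ℝ) : ℂ) =
      birkhoffSum (· + (α : UnitAddCircle)) F j t :=
    (map_birkhoffSum Complex.ofRealHom _ f j t).trans
      (birkhoffSum_comp_of_semiconj (h := ((↑) : ℝ → UnitAddCircle))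
        (fun s => AddCircle.coe_add 1 s α) F j t)
  rw [← Real.norm_eq_abs, ← Complex.norm_real, hsum]
  exact norm_birkhoffSum_le hmean hC hQ hsep hj t

theorem hasDerivAt_birkhoffSum {𝕜 E : Type*} [NontriviallyNormedField 𝕜] [NormedAddCommGroup E]
    [NormedSpace 𝕜 E] {f : 𝕜 → E} (hf : Differentiable 𝕜 f) (a : 𝕜) (j : ℕ) (t : 𝕜) :
    HasDerivAt (birkhoffSum (· + a) f j) (birkhoffSum (· + a) (deriv f) j t) t := by
  unfold birkhoffSum
  refine HasDerivAt.fun_sum fun i _ => ?_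
  simp only [add_right_iterate]
  exact (hf _).hasDerivAt.comp_add_const t (i • a)

theorem integral_deriv_eq_zero_of_periodic {E : Type*} [NormedAddCommGroup E] [NormedSpace ℝ E]
    [CompleteSpace E] {f : ℝ → E} {c : ℝ} (hf : ContDiff ℝ 1 f) (hp : Function.Periodic f c) :
    ∫ t in (0 : ℝ)..c, deriv f t = 0 := by
  rw [intervalIntegral.integral_deriv_eq_sub (fun x _ => hf.differentiable one_ne_zero x)
    ((hf.continuous_deriv le_rfl).intervalIntegrable _ _), hp.eq, sub_self]

theorem exists_abs_birkhoffSum_sub_le (α : ℝ) {M : ℕ} {f : ℝ → ℝ}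
    (hf : ContDiff ℝ (M + 3 : ℕ) f) (hp : Function.Periodic f 1) :
    ∃ C : ℝ, ∀ Q : ℕ, 0 < Q → SeparatedUpTo α Q → ∀ j ≤ Q ^ M, ∀ t t' : ℝ,
      |birkhoffSum (· + α) f j t' - birkhoffSum (· + α) f j t| ≤ C * (Q : ℝ) ^ 2 * |t' - t| := by
  have hf1 : ContDiff ℝ 1 f := hf.of_le (by norm_cast; omega)
  have hf' : ContDiff ℝ (M + 2 : ℕ) (deriv f) :=
    (contDiff_succ_iff_deriv.1 (by exact_mod_cast hf)).2.2
  obtain ⟨C, hC⟩ := exists_abs_birkhoffSum_le α hf' (periodic_deriv hp)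
    (integral_deriv_eq_zero_of_periodic hf1 hp)
  exact ⟨C, fun Q hQ hsep j hj t t' => Convex.norm_image_sub_le_of_norm_hasDerivWithin_le
    (fun x _ => (hasDerivAt_birkhoffSum (hf1.differentiable one_ne_zero) α j x).hasDerivWithinAt)
    (fun x _ => hC Q hQ hsep j hj x) convex_univ (Set.mem_univ t) (Set.mem_univ t')⟩

end Rotation

namespace Heisenberg

/-- The element `exp (a (X + Y) + b Z)`, where `X`, `Y`, `Z` is the standard basis of the Lie
algebra, with `[X, Y] = Z`. These elements form a commutative subgroup, which contains every
element by which the skew product translates. -/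
noncomputable def diagExp (a b : ℝ) : Heisenberg := ⟨a, a, b + a ^ 2 / 2⟩

theorem diagExp_zero : diagExp 0 0 = 1 := by ext <;> simp [diagExp]

theorem diagExp_mul (a b a' b' : ℝ) :
    diagExp a b * diagExp a' b' = diagExp (a + a') (b + b') := by
  simp only [diagExp, Heisenberg.ext_iff, mul_x, mul_y, mul_z, true_and]
  ring

/-- The cube of side `2 * r` around the identity, in the coordinates `x`, `y`, `z`. -/
def box (r : ℝ) : Set Heisenberg := {u | |u.x| ≤ r ∧ |u.y| ≤ r ∧ |u.z| ≤ r}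

theorem box_subset_box {r r' : ℝ} (h : r ≤ r') : box r ⊆ box r' :=
  fun _ hu => ⟨hu.1.trans h, hu.2.1.trans h, hu.2.2.trans h⟩

theorem hasBasis_nhds_one : (𝓝 (1 : Heisenberg)).HasBasis (0 < ·) box := by
  rw [coordsHomeo.isInducing.nhds_eq_comap]
  convert! (Metric.nhds_basis_closedBall (x := coordsHomeo 1)).comap coordsHomeo with r
  ext u
  simp [box, coordsHomeo, coords, Prod.dist_eq]

theorem inv_diagExp_mul_mul_diagExp_mem_box {a b a' b' L r : ℝ} {u : Heisenberg} (hL : 1 ≤ L)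
    (hLr : L * r ≤ 1) (ha : |a| ≤ L) (ha' : |a'| ≤ L) (haa' : |a' - a| ≤ L * r)
    (hbb' : |b' - b| ≤ L * r) (hu : u ∈ box r) :
    (diagExp a b)⁻¹ * u * diagExp a' b' ∈ box (5 * (L * r)) := by
  obtain ⟨hx, hy, hz⟩ := hu
  have hr0 : 0 ≤ r := (abs_nonneg _).trans hx
  have hr : r ≤ L * r := le_mul_of_one_le_left hr0 hL
  have hay : |a * u.y| ≤ L * r := by rw [abs_mul]; gcongr
  have hxa' : |u.x * a'| ≤ L * r := by rw [abs_mul, mul_comm L]; gcongr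
  have hsq : (a' - a) ^ 2 / 2 ≤ L * r := by
    rw [← sq_abs]
    nlinarith [abs_nonneg (a' - a)]
  have hsq0 : 0 ≤ (a' - a) ^ 2 / 2 := by positivity
  have hzcoord : ((diagExp a b)⁻¹ * u * diagExp a' b').z =
      u.z - a * u.y + u.x * a' + (b' - b) + (a' - a) ^ 2 / 2 := by
    simp only [diagExp, mul_x, mul_z, inv_x, inv_z]
    ring
  simp only [box, Set.mem_ofPred_eq, hzcoord]
  simp only [diagExp, mul_x, mul_y, inv_x, inv_y]
  simp only [abs_le] at *
  refine ⟨⟨?_, ?_⟩, ⟨?_, ?_⟩, ?_, ?_⟩ <;> linarith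

end Heisenberg

namespace HeisenbergNilmanifold

theorem isOpenQuotientMap_mk : IsOpenQuotientMap mk :=
  MulAction.isOpenQuotientMap_quotientMk (Γ := Heisenberg.lattice) (T := Heisenberg)

theorem continuous_rightTranslate :
    Continuous fun p : HeisenbergNilmanifold × Heisenberg => rightTranslate p.2 p.1 := by
  rw [← (isOpenQuotientMap_mk.prodMap (IsOpenQuotientMap.id (X := Heisenberg))).continuous_comp_iff]
  exact isOpenQuotientMap_mk.continuous.comp continuous_mul

end HeisenbergNilmanifold

section Translate

/-- The right action of `ℝ × G` on `𝕋 × Γ \ G` by translations. -/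
noncomputable def translatePoint (p : UnitAddCircle × HeisenbergNilmanifold) (v : ℝ × Heisenberg) :
    UnitAddCircle × HeisenbergNilmanifold :=
  (p.1 + (v.1 : UnitAddCircle), HeisenbergNilmanifold.rightTranslate v.2 p.2)

theorem translatePoint_mk (t s : ℝ) (g u : Heisenberg) :
    translatePoint ((t : UnitAddCircle), HeisenbergNilmanifold.mk g) (s, u) =
      (((t + s : ℝ) : UnitAddCircle), HeisenbergNilmanifold.mk (g * u)) := rfl

theorem exists_eq_coe_mk (p : UnitAddCircle × HeisenbergNilmanifold) :
    ∃ (t : ℝ) (g : Heisenberg), p = ((t : UnitAddCircle), HeisenbergNilmanifold.mk g) := by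
  obtain ⟨t, ht⟩ := QuotientAddGroup.mk_surjective p.1
  obtain ⟨g, hg⟩ := HeisenbergNilmanifold.isOpenQuotientMap_mk.surjective p.2
  exact ⟨t, g, Prod.ext ht.symm hg.symm⟩

theorem translatePoint_zero_one (p : UnitAddCircle × HeisenbergNilmanifold) :
    translatePoint p (0, 1) = p := by
  obtain ⟨t, g, rfl⟩ := exists_eq_coe_mk p
  rw [translatePoint_mk, add_zero, mul_one]

theorem continuous_translatePoint : Continuous fun q :
    (UnitAddCircle × HeisenbergNilmanifold) × (ℝ × Heisenberg) => translatePoint q.1 q.2 :=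
  (continuous_fst.fst.add ((AddCircle.continuous_mk' 1).comp continuous_snd.fst)).prodMk
    (HeisenbergNilmanifold.continuous_rightTranslate.comp
      (continuous_fst.snd.prodMk continuous_snd.snd))

theorem continuous_uncurry_dist {Y : Type*} [tY : TopologicalSpace Y] (m : PseudoMetricSpace Y)
    (hm : m.toUniformSpace.toTopologicalSpace = tY) : Continuous (Function.uncurry m.dist) := by
  subst hm
  exact continuous_dist

theorem eventually_forall_lt {Y P : Type*} [TopologicalSpace Y] [CompactSpace Y]
    [TopologicalSpace P] {a : Y → P → Y} (ha : Continuous (Function.uncurry a)) {p₀ : P}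
    (hp₀ : ∀ y, a y p₀ = y) {d : Y → Y → ℝ} (hd : Continuous (Function.uncurry d))
    (hd0 : ∀ y, d y y = 0) {ε : ℝ} (hε : 0 < ε) : ∀ᶠ p in 𝓝 p₀, ∀ y, d y (a y p) < ε := by
  have hcont : Continuous fun q : P × Y => d q.2 (a q.2 q.1) :=
    hd.comp (continuous_snd.prodMk (ha.comp continuous_swap))
  have hlocal : ∀ y ∈ Set.univ, ∀ᶠ q : P × Y in 𝓝 (p₀, y), d q.2 (a q.2 q.1) < ε :=
    fun y _ => hcont.continuousAt.eventually_lt continuousAt_const (by simpa [hp₀, hd0] using hε)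
  simpa using isCompact_univ.eventually_forall_of_forall_eventually hlocal

theorem exists_forall_translatePoint_lt
    {d : UnitAddCircle × HeisenbergNilmanifold → UnitAddCircle × HeisenbergNilmanifold → ℝ}
    (hd : Continuous (Function.uncurry d)) (hd0 : ∀ p, d p p = 0) {ε : ℝ} (hε : 0 < ε) :
    ∃ δ > 0, ∀ (s : ℝ) (u : Heisenberg), |s| ≤ δ → u ∈ Heisenberg.box δ →
      ∀ p, d p (translatePoint p (s, u)) < ε := by
  have hbasis : (𝓝 ((0 : ℝ), (1 : Heisenberg))).HasBasis (0 < ·)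
      fun δ => Metric.closedBall 0 δ ×ˢ Heisenberg.box δ := by
    rw [nhds_prod_eq]
    refine Metric.nhds_basis_closedBall.prod_same_index_mono Heisenberg.hasBasis_nhds_one ?_ ?_
    · exact fun _ _ _ _ h => Metric.closedBall_subset_closedBall h
    · exact fun _ _ _ _ h => Heisenberg.box_subset_box h
  obtain ⟨δ, hδ, hsub⟩ := hbasis.eventually_iff.1
    (eventually_forall_lt continuous_translatePoint translatePoint_zero_one hd hd0 hε)
  exact ⟨δ, hδ, fun s u hs hu => hsub (x := (s, u)) ⟨by simpa using hs, hu⟩⟩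

end Translate

section Orbits

/-- The `j`-th iterate of the cocycle of the skew product, see `iterate_skewProduct`. Since its
generator `⟨φ, φ, ψ⟩ = diagExp φ (ψ - φ ^ 2 / 2)` takes values in a commutative subgroup, two
Birkhoff sums determine it. -/
noncomputable def skewCocycle (α : ℝ) (φ ψ : ℝ → ℝ) (j : ℕ) (t : ℝ) : Heisenberg :=
  Heisenberg.diagExp (birkhoffSum (· + α) φ j t)
    (birkhoffSum (· + α) (fun t => ψ t - φ t ^ 2 / 2) j t)

theorem skewCocycle_zero (α : ℝ) (φ ψ : ℝ → ℝ) (t : ℝ) : skewCocycle α φ ψ 0 t = 1 := by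
  simp only [skewCocycle, birkhoffSum_zero, Heisenberg.diagExp_zero]

theorem skewCocycle_succ (α : ℝ) (φ ψ : ℝ → ℝ) (j : ℕ) (t : ℝ) :
    skewCocycle α φ ψ (j + 1) t = skewCocycle α φ ψ j t *
      ⟨φ ((· + α)^[j] t), φ ((· + α)^[j] t), ψ ((· + α)^[j] t)⟩ := by
  simp only [skewCocycle, birkhoffSum_succ, ← Heisenberg.diagExp_mul]
  simp only [Heisenberg.diagExp, sub_add_cancel]

variable {φ ψ : ℝ → ℝ}

theorem iterate_skewProduct (α : ℝ) (hφ : Function.Periodic φ 1) (hψ : Function.Periodic ψ 1)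
    (j : ℕ) (t : ℝ) (g : Heisenberg) :
    (skewProduct α hφ hψ)^[j] ((t : UnitAddCircle), HeisenbergNilmanifold.mk g) =
      ((((· + α)^[j] t : ℝ) : UnitAddCircle),
        HeisenbergNilmanifold.mk (g * skewCocycle α φ ψ j t)) := by
  induction j with
  | zero => simp only [Function.iterate_zero, id, skewCocycle_zero, mul_one]
  | succ j ih =>
    rw [Function.iterate_succ_apply', ih, Function.iterate_succ_apply', skewCocycle_succ,
      ← mul_assoc]
    rfl

theorem iterate_skewProduct_translatePoint (α : ℝ) (hφ : Function.Periodic φ 1)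
    (hψ : Function.Periodic ψ 1) (j : ℕ) (t s : ℝ) (g u : Heisenberg) :
    (skewProduct α hφ hψ)^[j]
        (translatePoint ((t : UnitAddCircle), HeisenbergNilmanifold.mk g) (s, u)) =
      translatePoint ((skewProduct α hφ hψ)^[j] ((t : UnitAddCircle), HeisenbergNilmanifold.mk g))
        (s, (skewCocycle α φ ψ j t)⁻¹ * u * skewCocycle α φ ψ j (t + s)) := by
  rw [translatePoint_mk, iterate_skewProduct, iterate_skewProduct, translatePoint_mk]
  congr 2
  · simp only [add_right_iterate]
    ring
  · group

theorem exists_inv_skewCocycle_mul_mul_mem_box (α : ℝ) (hφ : ContDiff ℝ ∞ φ) (hψ : ContDiff ℝ ∞ ψ)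
    (hφp : Function.Periodic φ 1) (hψp : Function.Periodic ψ 1)
    (hφ0 : ∫ t in (0 : ℝ)..1, φ t = 0) (M : ℕ) :
    ∃ L ≥ 1, ∀ Q : ℕ, 0 < Q → SeparatedUpTo α Q → ∀ j ≤ Q ^ M, ∀ (t s r : ℝ) (u : Heisenberg),
      L * Q ^ 2 * r ≤ 1 → |s| ≤ r → u ∈ Heisenberg.box r →
      (skewCocycle α φ ψ j t)⁻¹ * u * skewCocycle α φ ψ j (t + s) ∈
        Heisenberg.box (5 * (L * Q ^ 2 * r)) := by
  have hη : ContDiff ℝ ∞ fun t => ψ t - φ t ^ 2 / 2 := hψ.sub ((hφ.pow 2).div_const 2)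
  have hηp : Function.Periodic (fun t => ψ t - φ t ^ 2 / 2) 1 := fun t => by
    simp only [hφp t, hψp t]
  have hsmooth (N : ℕ) : (N : WithTop ℕ∞) ≤ (∞ : WithTop ℕ∞) := by exact_mod_cast le_top
  obtain ⟨C₁, hφsum⟩ := exists_abs_birkhoffSum_le α (hφ.of_le (hsmooth (M + 2))) hφp hφ0
  obtain ⟨C₂, hφlip⟩ := exists_abs_birkhoffSum_sub_le α (hφ.of_le (hsmooth (M + 3))) hφp
  obtain ⟨C₃, hηlip⟩ := exists_abs_birkhoffSum_sub_le α (hη.of_le (hsmooth (M + 3))) hηp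
  obtain ⟨L, hL⟩ := Finset.exists_le ({C₁, C₂, C₃, 1} : Finset ℝ)
  simp only [Finset.mem_insert, Finset.mem_singleton, forall_eq_or_imp, forall_eq] at hL
  obtain ⟨h₁, h₂, h₃, hL1⟩ := hL
  refine ⟨L, hL1, fun Q hQ hsep j hj t s r u hr hs hu => ?_⟩
  have hQ1 : (1 : ℝ) ≤ (Q : ℝ) ^ 2 := one_le_pow₀ (by exact_mod_cast hQ)
  have hsum (x : ℝ) : |birkhoffSum (· + α) φ j x| ≤ L * Q ^ 2 :=
    (hφsum Q hQ hsep j hj x).trans (by gcongr)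
  refine Heisenberg.inv_diagExp_mul_mul_diagExp_mem_box
    (one_le_mul_of_one_le_of_one_le hL1 hQ1) hr (hsum t) (hsum (t + s)) ?_ ?_ hu
  · refine (hφlip Q hQ hsep j hj t (t + s)).trans ?_
    rw [add_sub_cancel_left]
    gcongr
  · refine (hηlip Q hQ hsep j hj t (t + s)).trans ?_
    rw [add_sub_cancel_left]
    gcongr

theorem exists_forall_iterate_skewProduct_lt (α : ℝ) (hφ : ContDiff ℝ ∞ φ) (hψ : ContDiff ℝ ∞ ψ)
    (hφp : Function.Periodic φ 1) (hψp : Function.Periodic ψ 1)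
    (hφ0 : ∫ t in (0 : ℝ)..1, φ t = 0) (M : ℕ)
    {d : UnitAddCircle × HeisenbergNilmanifold → UnitAddCircle × HeisenbergNilmanifold → ℝ}
    (hd : Continuous (Function.uncurry d)) (hd0 : ∀ p, d p p = 0) {ε : ℝ} (hε : 0 < ε) :
    ∃ κ > 0, ∀ Q : ℕ, 0 < Q → SeparatedUpTo α Q → ∀ (s : ℝ) (u : Heisenberg),
      |s| ≤ κ / Q ^ 2 → u ∈ Heisenberg.box (κ / Q ^ 2) → ∀ p, ∀ j ≤ Q ^ M,
      d ((skewProduct α hφp hψp)^[j] p) ((skewProduct α hφp hψp)^[j] (translatePoint p (s, u))) <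
        ε := by
  obtain ⟨δ, hδ, hclose⟩ := exists_forall_translatePoint_lt hd hd0 hε
  obtain ⟨L, hL, hbox⟩ := exists_inv_skewCocycle_mul_mul_mem_box α hφ hψ hφp hψp hφ0 M
  refine ⟨min δ 1 / (5 * L), by positivity, fun Q hQ hsep s u hs hu p j hj => ?_⟩
  have hQ1 : (1 : ℝ) ≤ (Q : ℝ) ^ 2 := one_le_pow₀ (by exact_mod_cast hQ)
  have hscale : 5 * (L * Q ^ 2 * (min δ 1 / (5 * L) / Q ^ 2)) = min δ 1 := by field_simp
  have hle_one : L * Q ^ 2 * (min δ 1 / (5 * L) / Q ^ 2) ≤ 1 := by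
    linarith [min_le_right δ 1]
  have hle_delta : min δ 1 / (5 * L) / Q ^ 2 ≤ δ :=
    calc min δ 1 / (5 * L) / Q ^ 2 ≤ min δ 1 :=
          (div_le_self (by positivity) hQ1).trans (div_le_self (by positivity) (by linarith))
      _ ≤ δ := min_le_left δ 1
  obtain ⟨t, g, rfl⟩ := exists_eq_coe_mk p
  rw [iterate_skewProduct_translatePoint]
  refine hclose _ _ (hs.trans hle_delta) (Heisenberg.box_subset_box ?_
    (hbox Q hQ hsep j hj t s _ u hle_one hs hu)) _
  exact hscale.trans_le (min_le_left δ 1)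

end Orbits

section Counting

theorem mem_meanOrbitBall_of_forall_lt {X : Type*} {d : X → X → ℝ} {T : X → X} {n : ℕ} {x y : X}
    {ε : ℝ} (hε : 0 < ε) (h : ∀ j < n, d (T^[j] x) (T^[j] y) < ε) :
    y ∈ meanOrbitBall d T n x ε := by
  rw [meanOrbitBall, Set.mem_ofPred_eq, meanOrbitDist]
  rcases n.eq_zero_or_pos with rfl | hn
  · simpa using hε
  · have hsum := Finset.sum_lt_sum_of_nonempty (Finset.nonempty_range_iff.2 hn.ne')
      fun j hj => h j (Finset.mem_range.1 hj)
    rw [Finset.sum_const, Finset.card_range, nsmul_eq_mul] at hsum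
    rwa [one_div, inv_mul_lt_iff₀ (by exact_mod_cast hn)]

theorem coveringNumber_le_card {X ι : Type*} [MeasurableSpace X] [Fintype ι] {d : X → X → ℝ}
    {T : X → X} {ρ : Measure X} [IsProbabilityMeasure ρ] {ε : ℝ} (hε : 0 < ε) {n : ℕ} (c : ι → X)
    (hc : ∀ y, ∃ i, y ∈ meanOrbitBall d T n (c i) ε) :
    coveringNumber d T ρ ε n ≤ Fintype.card ι := by
  refine iInf₂_le_of_le (Fintype.card ι) ⟨c ∘ (Fintype.equivFin ι).symm, ?_⟩ le_rfl
  have hcover : ⋃ j, meanOrbitBall d T n ((c ∘ (Fintype.equivFin ι).symm) j) ε = Set.univ :=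
    Set.iUnion_eq_univ_iff.2 fun y => by
      obtain ⟨i, hi⟩ := hc y
      exact ⟨Fintype.equivFin ι i, by simpa using hi⟩
  rw [hcover, probReal_univ]
  linarith

theorem exists_fin_abs_sub_le {N : ℕ} (hN : 0 < N) {x : ℝ} (hx : x ∈ Set.Ico (0 : ℝ) 1) :
    ∃ k : Fin N, |x - (k : ℕ) / N| ≤ 1 / N := by
  have hN' : (0 : ℝ) < N := by exact_mod_cast hN
  have hNx : 0 ≤ N * x := mul_nonneg hN'.le hx.1
  refine ⟨⟨⌊N * x⌋₊, (Nat.floor_lt hNx).2 (mul_lt_of_lt_one_right hN' hx.2)⟩, ?_⟩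
  have hscale : x - (⌊N * x⌋₊ : ℝ) / N = (N * x - ⌊N * x⌋₊) / N := by field_simp
  rw [hscale, abs_div, abs_of_pos hN', abs_of_nonneg (sub_nonneg.2 (Nat.floor_le hNx))]
  gcongr
  linarith [Nat.lt_floor_add_one (N * x)]

theorem exists_coe_eq_fin_div_add {N : ℕ} (hN : 0 < N) (x : UnitAddCircle) :
    ∃ (k : Fin N) (s : ℝ), |s| ≤ 1 / N ∧ x = (((k : ℕ) / N + s : ℝ) : UnitAddCircle) := by
  obtain ⟨t, ht, rfl⟩ : x ∈ ((↑) : ℝ → UnitAddCircle) '' Set.Ico 0 (0 + 1) := by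
    rw [AddCircle.coe_image_Ico_eq]
    exact Set.mem_univ x
  obtain ⟨k, hk⟩ := exists_fin_abs_sub_le hN (by simpa using ht)
  exact ⟨k, t - (k : ℕ) / N, hk, by rw [add_sub_cancel]⟩

theorem HeisenbergNilmanifold.exists_mk_eq (y : HeisenbergNilmanifold) :
    ∃ g : Heisenberg, g.x ∈ Set.Ico (0 : ℝ) 1 ∧ g.y ∈ Set.Ico (0 : ℝ) 1 ∧
      g.z ∈ Set.Ico (0 : ℝ) 1 ∧ mk g = y := by
  obtain ⟨g, rfl⟩ := isOpenQuotientMap_mk.surjective y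
  have hfract (r : ℝ) : Int.fract r ∈ Set.Ico (0 : ℝ) 1 := ⟨Int.fract_nonneg r, Int.fract_lt_one r⟩
  let z := g.z - ⌊g.x⌋ * Int.fract g.y
  refine ⟨⟨Int.fract g.x, Int.fract g.y, Int.fract z⟩, hfract _, hfract _, hfract _, ?_⟩
  refine (mk_eq_mk_iff _ _).2 ⟨⟨⌊g.x⌋, ⌊g.y⌋, ⌊z⌋⟩, ⟨_, _, _, rfl⟩, ?_⟩
  ext
  · exact (Int.floor_add_fract g.x).symm
  · exact (Int.floor_add_fract g.y).symm
  · rw [Heisenberg.mul_z, Int.floor_add_fract, sub_add_cancel]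

/-- The points of the grid of mesh `1 / N` in the unit cube. -/
noncomputable def Heisenberg.gridPoint (N : ℕ) (k : Fin N × Fin N × Fin N) : Heisenberg :=
  ⟨(k.1 : ℕ) / N, (k.2.1 : ℕ) / N, (k.2.2 : ℕ) / N⟩

theorem HeisenbergNilmanifold.exists_mk_gridPoint_mul_eq {N : ℕ} (hN : 0 < N)
    (y : HeisenbergNilmanifold) :
    ∃ k : Fin N × Fin N × Fin N, ∃ u ∈ Heisenberg.box (2 / N),
      y = mk (Heisenberg.gridPoint N k * u) := by
  obtain ⟨g, hx, hy, hz, rfl⟩ := exists_mk_eq y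
  obtain ⟨k₁, h₁⟩ := exists_fin_abs_sub_le hN hx
  obtain ⟨k₂, h₂⟩ := exists_fin_abs_sub_le hN hy
  obtain ⟨k₃, h₃⟩ := exists_fin_abs_sub_le hN hz
  have hle : 1 / (N : ℝ) ≤ 2 / N := by gcongr; exact one_le_two
  have hk₁ : ((k₁ : ℕ) : ℝ) / N ≤ 1 :=
    div_le_one_of_le₀ (by exact_mod_cast k₁.2.le) N.cast_nonneg
  refine ⟨(k₁, k₂, k₃), (Heisenberg.gridPoint N (k₁, k₂, k₃))⁻¹ * g, ⟨?_, ?_, ?_⟩, ?_⟩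
  · rw [Heisenberg.mul_x, Heisenberg.inv_x, neg_add_eq_sub]
    exact h₁.trans hle
  · rw [Heisenberg.mul_y, Heisenberg.inv_y, neg_add_eq_sub]
    exact h₂.trans hle
  · have hzcoord : ((Heisenberg.gridPoint N (k₁, k₂, k₃))⁻¹ * g).z =
        g.z - (k₃ : ℕ) / N - (k₁ : ℕ) / N * (g.y - (k₂ : ℕ) / N) := by
      simp only [Heisenberg.gridPoint, Heisenberg.mul_z, Heisenberg.inv_z, Heisenberg.inv_x]
      ring
    calc |((Heisenberg.gridPoint N (k₁, k₂, k₃))⁻¹ * g).z|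
        ≤ |g.z - (k₃ : ℕ) / N| + (k₁ : ℕ) / N * |g.y - (k₂ : ℕ) / N| := by
          rw [hzcoord]
          refine (abs_sub _ _).trans_eq ?_
          rw [abs_mul, abs_of_nonneg (by positivity : (0 : ℝ) ≤ (k₁ : ℕ) / N)]
      _ ≤ 1 / N + 1 * (1 / N) := by gcongr
      _ = 2 / N := by ring
  · rw [mul_inv_cancel_left]

theorem exists_eq_translatePoint_gridPoint {N : ℕ} (hN : 0 < N)
    (p : UnitAddCircle × HeisenbergNilmanifold) :
    ∃ (k : Fin N × Fin N × Fin N × Fin N) (s : ℝ) (u : Heisenberg), |s| ≤ 2 / N ∧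
      u ∈ Heisenberg.box (2 / N) ∧
      p = translatePoint ((((k.1 : ℕ) / N : ℝ) : UnitAddCircle),
        HeisenbergNilmanifold.mk (Heisenberg.gridPoint N k.2)) (s, u) := by
  obtain ⟨x, y⟩ := p
  obtain ⟨k₀, s, hs, rfl⟩ := exists_coe_eq_fin_div_add hN x
  obtain ⟨k, u, hu, rfl⟩ := HeisenbergNilmanifold.exists_mk_gridPoint_mul_eq hN y
  exact ⟨(k₀, k), s, u, hs.trans (by gcongr; exact one_le_two), hu, rfl⟩

theorem exists_coveringNumber_skewProduct_le (α : ℝ) {φ ψ : ℝ → ℝ} (hφ : ContDiff ℝ ∞ φ)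
    (hψ : ContDiff ℝ ∞ ψ) (hφp : Function.Periodic φ 1) (hψp : Function.Periodic ψ 1)
    (hφ0 : ∫ t in (0 : ℝ)..1, φ t = 0)
    (ρ : Measure (UnitAddCircle × HeisenbergNilmanifold)) [IsProbabilityMeasure ρ]
    {d : UnitAddCircle × HeisenbergNilmanifold → UnitAddCircle × HeisenbergNilmanifold → ℝ}
    (hd : Continuous (Function.uncurry d)) (hd0 : ∀ p, d p p = 0) {ε : ℝ} (hε : 0 < ε) (M : ℕ) :
    ∃ K : ℕ, ∀ Q : ℕ, 0 < Q → SeparatedUpTo α Q →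
      coveringNumber d (skewProduct α hφp hψp) ρ ε (Q ^ M) ≤ (K * Q ^ 8 : ℕ) := by
  obtain ⟨κ, hκ, hclose⟩ :=
    exists_forall_iterate_skewProduct_lt α hφ hψ hφp hψp hφ0 M hd hd0 hε
  obtain ⟨K, hK⟩ := exists_nat_gt (2 / κ)
  have hK0 : (0 : ℝ) < K := lt_trans (by positivity) hK
  refine ⟨K ^ 4, fun Q hQ hsep => ?_⟩
  have hN : 0 < K * Q ^ 2 := mul_pos (by exact_mod_cast hK0) (by positivity)
  have hmesh : (2 : ℝ) / (K * Q ^ 2 : ℕ) ≤ κ / Q ^ 2 := by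
    push_cast
    rw [← div_div]
    gcongr
    exact (div_le_comm₀ hκ hK0).1 hK.le
  refine (coveringNumber_le_card hε (fun k : Fin (K * Q ^ 2) × _ × _ × _ =>
    ((((k.1 : ℕ) / (K * Q ^ 2 : ℕ) : ℝ) : UnitAddCircle),
      HeisenbergNilmanifold.mk (Heisenberg.gridPoint (K * Q ^ 2) k.2))) fun p => ?_).trans_eq ?_
  · obtain ⟨k, s, u, hs, hu, rfl⟩ := exists_eq_translatePoint_gridPoint hN p
    exact ⟨k, mem_meanOrbitBall_of_forall_lt hε fun j hj => hclose Q hQ hsep s u (hs.trans hmesh)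
      (Heisenberg.box_subset_box hmesh hu) _ j hj.le⟩
  · simp only [Fintype.card_prod, Fintype.card_fin]
    congr 1
    ring

end Counting

theorem natCast_pow_le_ofReal_pow_rpow {Q M n : ℕ} {τ : ℝ} (hQ : 0 < Q) (hn : n ≤ M * τ) :
    (Q : ℝ≥0∞) ^ n ≤ ENNReal.ofReal (((Q ^ M : ℕ) : ℝ) ^ τ) := by
  rw [← ENNReal.ofReal_natCast, ← ENNReal.ofReal_pow Q.cast_nonneg, Nat.cast_pow,
    ← Real.rpow_natCast, ← Real.rpow_natCast, ← Real.rpow_mul Q.cast_nonneg]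
  exact ENNReal.ofReal_le_ofReal (Real.rpow_le_rpow_of_exponent_le (by exact_mod_cast hQ) hn)

theorem liminf_div_rpow_eq_zero {a : ℕ → ℝ≥0∞} {D : ℕ}
    (ha : ∀ M : ℕ, ∃ K : ℕ, ∃ᶠ Q : ℕ in atTop, a (Q ^ M) ≤ K * (Q : ℝ≥0∞) ^ D) {τ : ℝ}
    (hτ : 0 < τ) : liminf (fun n : ℕ => a n / ENNReal.ofReal ((n : ℝ) ^ τ)) atTop = 0 := by
  obtain ⟨M, hM⟩ := exists_nat_gt ((D + 1 : ℕ) / τ)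
  have hM0 : M ≠ 0 := by
    have : (0 : ℝ) < M := lt_of_le_of_lt (by positivity) hM
    exact_mod_cast this.ne'
  obtain ⟨K, hK⟩ := ha M
  have hratio {Q : ℕ} (hQ : 0 < Q) (h : a (Q ^ M) ≤ K * (Q : ℝ≥0∞) ^ D) :
      a (Q ^ M) / ENNReal.ofReal (((Q ^ M : ℕ) : ℝ) ^ τ) ≤ K * (Q : ℝ≥0∞)⁻¹ := by
    refine ENNReal.div_le_of_le_mul ?_
    calc a (Q ^ M) ≤ K * (Q : ℝ≥0∞) ^ D := h
      _ = K * (Q : ℝ≥0∞)⁻¹ * (Q : ℝ≥0∞) ^ (D + 1) := by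
          rw [pow_succ', mul_assoc, ← mul_assoc _ (Q : ℝ≥0∞),
            ENNReal.inv_mul_cancel (by exact_mod_cast hQ.ne') (ENNReal.natCast_ne_top Q), one_mul]
      _ ≤ K * (Q : ℝ≥0∞)⁻¹ * ENNReal.ofReal (((Q ^ M : ℕ) : ℝ) ^ τ) := by
          gcongr
          exact natCast_pow_le_ofReal_pow_rpow hQ ((div_lt_iff₀ hτ).1 hM).le
  have hlim : Tendsto (fun Q : ℕ => K * (Q : ℝ≥0∞)⁻¹) atTop (𝓝 0) := by
    simpa using ENNReal.Tendsto.const_mul ENNReal.tendsto_inv_nat_nhds_zero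
      (Or.inr (ENNReal.natCast_ne_top K))
  refine le_antisymm (le_of_forall_gt_imp_ge_of_dense fun δ hδ => ?_) zero_le
  refine liminf_le_of_frequently_le' ((tendsto_pow_atTop hM0).frequently ?_)
  refine (hK.and_eventually ((hlim.eventually (gt_mem_nhds hδ)).and
    (eventually_gt_atTop 0))).mono ?_
  rintro Q ⟨hQa, hQδ, hQ⟩
  exact (hratio hQ hQa).trans hQδ.le

theorem proposition6p1_general {α : ℝ} (hirr : Irrational α) {φ ψ : ℝ → ℝ}
    (hφ : ContDiff ℝ ∞ φ) (hψ : ContDiff ℝ ∞ ψ)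
    (hφp : Function.Periodic φ 1) (hψp : Function.Periodic ψ 1)
    (hφ0 : ∫ t in (0 : ℝ)..1, φ t = 0)
    (ρ : Measure (UnitAddCircle × HeisenbergNilmanifold)) [IsProbabilityMeasure ρ] :
    SubpolynomialMeasureComplexity (skewProduct α hφp hψp) ρ := by
  intro τ hτ m hm ε hε
  refine liminf_div_rpow_eq_zero (D := 8) (fun M => ?_) hτ
  obtain ⟨K, hK⟩ := exists_coveringNumber_skewProduct_le α hφ hψ hφp hψp hφ0 ρ
    (continuous_uncurry_dist m.toPseudoMetricSpace hm) m.dist_self hε M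
  refine ⟨K, ((frequently_separatedUpTo hirr).and_eventually (eventually_gt_atTop 0)).mono ?_⟩
  rintro Q ⟨hsep, hQ⟩
  exact_mod_cast ENat.toENNReal_le.2 (hK Q hQ hsep)

theorem proposition6p1 (α : ℝ) (hα : α ∈ Set.Ico (0 : ℝ) 1) (hirr : Irrational α)
    (φ ψ : ℝ → ℝ) (hφ : ContDiff ℝ ∞ φ) (hψ : ContDiff ℝ ∞ ψ)
    (hφp : Function.Periodic φ 1) (hψp : Function.Periodic ψ 1)
    (hφ0 : ∫ t in (0 : ℝ)..1, φ t = 0)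
    (ρ : Measure (UnitAddCircle × HeisenbergNilmanifold)) [IsProbabilityMeasure ρ]
    (hρ : MeasurePreserving (skewProduct α hφp hψp) ρ ρ) :
    SubpolynomialMeasureComplexity (skewProduct α hφp hψp) ρ :=
  proposition6p1_general hirr hφ hψ hφp hψp hφ0 ρ
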